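/- **Theorem (Main result).** Let $\mathcal X$ be a measurable space, $p\in\mathbb N$, and let $\mathcal D$ be a probability distribution over $\mathcal X\times\{0,1\}\times[p]$, with draws written $(X,Y,Z)$. Let $\mathcal F\subseteq\{0,1\}^{\mathcal X\times[p]}$ be a class of measurable classifiers with VC dimension $d\in\mathbb N$ (the largest size of a set shattered by $\mathcal F$), such that for all $n$ and $b\in\{0,1\}^n$ the set of $n$-tuples of data points $(x_i,y_i,z_i)$ for which some $f\in\mathcal F$ satisfies $f(x_i,z_i)=b_i$ for all $i$ is $\mathcal D^n$-measurable (the usual measurability convention of VC theory). Let $\mathcal E(f),\mathcal E'(f)$ be two events that are determined, through fixed measurable sets, by the data point $(X,Y,Z)$ and the prediction $f(X,Z)$. For a distribution $\mathcal P$ on $\mathcal X\times\{0,1\}\times[p]$ put $$\mathrm{Err}_{\mathcal P}(f)=\Pr_{\mathcal P}[f(X,Z)\ne Y],\quad q_\ell(f)=\Pr_{\mathcal P}[\mathcal E(f)\mid \mathcal E'(f),Z=\ell],\quad \Omega_{\mathcal P}(f)=\frac{\min_{\ell\in[p]}q_\ell(f)}{\max_{\ell\in[p]}q_\ell(f)},$$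 where $q_\ell(f)=0$ if the conditioning event is null and $0/0=0$. Let $\tau\in(0,1]$ and let $f^\star$ minimize $\mathrm{Err}_{\mathcal D}(f)$ over all $f\in\mathcal F$ with $\Omega_{\mathcal D}(f)\ge\tau$. Suppose that $\lambda>0$ and $$\min_{\ell\in[p]}\Pr_{\mathcal D}[\mathcal E(f^\star),\mathcal E'(f^\star),Z=\ell]\ge\lambda .$$ Given samples $\widehat S=\{(x_i,y_i,\widehat z_i)\}_{i\in[N]}$ with empirical distribution $\widehat D$, the program ErrTolerant with parameters $\tau,\eta,\lambda,\Delta$ is to minimize $\mathrm{Err}_{\widehat D}(f)$ over all $f\in\mathcal F$ subject to $$\Omega_{\widehat D}(f)\ge\tau\left(\frac{1-(\eta+\Delta)/\lambda}{1+(\eta+\Delta)/\lambda}\right)^2\quad\text{and}\quad \Pr_{\widehat D}[\mathcal E(f),\mathcal E'(f),\widehat Z=\ell]\ge\lambda-\eta-\Delta\ \text{ for all }\ell\in[p].$$ An $\eta$-Hamming adversary is a (possibly randomized) map that takes $N$ independent samples $S=\{(x_i,y_i,z_i)\}_{i\in[N]}$ from $\mathcal D$ to some $\widehat S=\{(x_i,y_i,\widehat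 z_i)\}_{i\in[N]}$ with $\widehat z_i\ne z_i$ for at most $\eta N$ indices $i$. There is a polynomial $P$ in three variables, independent of all the data above and below, such that the following holds for all $\eta\in[0,\lambda/2)$, $\varepsilon>2\eta$, $\nu>\frac{8\eta\tau}{\lambda-2\eta}$, $\delta\in(0,1)$, every $\Delta$ with $$0<\Delta\le\frac1{96}\min\left\{\varepsilon-2\eta,\ (\lambda-2\eta)\left(\nu-\frac{8\eta\tau}{\lambda-2\eta}\right),\ \lambda-2\eta\right\},$$ every $N\ge P\left(d,\frac1\Delta,\log\frac p\delta\right)$ and every $\eta$-Hamming adversary. With probability at least $1-\delta$ over the samples and the randomness of the adversary, ErrTolerant with parameters $\tau,\eta,\lambda,\Delta$ on the perturbed samples $\widehat S$ has an optimal solution, and every optimal solution $f_{\rm ET}$ satisfies $$\mathrm{Err}_{\mathcal D}(f_{\rm ET})-\mathrm{Err}_{\mathcal D}(f^\star)\le\varepsilon\quad\text{and}\quad\Omega_{\mathcal D}(f_{\rm ET})\ge\tau-\nu .$$ -/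

import Mathlib

open MeasureTheory ProbabilityTheory

namespace FairLearning

/-- The data domain `𝒳 × {0,1} × [p]`: a point `(x, y, z)` has features `x`, label `y` and
protected attribute `z`. -/
abbrev Datum (X : Type*) (p : ℕ) := X × Bool × Fin p

/-- A binary classifier, which may use the protected attribute. -/
abbrev Classifier (X : Type*) (p : ℕ) := X × Fin p → Bool

/-- The prediction `f(x, z)` of `f` at the data point `(x, y, z)`. -/
def predict {X : Type*} {p : ℕ} (f : Classifier X p) (w : Datum X p) : Bool := f (w.1, w.2.2)

/-- `F` shatters the finite set `B`: every subset of `B` is cut out by some `f ∈ F`. -/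
def Shatters {X : Type*} {p : ℕ} (F : Set (Classifier X p)) (B : Finset (X × Fin p)) : Prop :=
  ∀ T ⊆ B, ∃ f ∈ F, ∀ a ∈ B, f a = true ↔ a ∈ T

/-- `F` has VC dimension `d`: the largest size of a shattered set is `d`. -/
def HasVCDim {X : Type*} {p : ℕ} (F : Set (Classifier X p)) (d : ℕ) : Prop :=
  IsGreatest {n : ℕ | ∃ B : Finset (X × Fin p), B.card = n ∧ Shatters F B} d

/-- An event whose occurrence at a data point `w` depends on `w` and on the prediction of the
classifier at `w`, as a set of pairs (prediction, data point). -/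
abbrev MetricEvent (X : Type*) (p : ℕ) := Set (Bool × Datum X p)

noncomputable section

variable {X : Type*} [MeasurableSpace X] {p : ℕ}

/-- The usual measurability convention of VC theory, for draws from `D`: every member of `F` is
measurable, and for each pattern `b` the set of samples on which some `f ∈ F` predicts exactly `b`
is measurable up to a null set. (It holds e.g. if `F` is countable, or if `F` has a countable
subclass from which every member is a pointwise limit.) -/
def IsMeasurableClass (F : Set (Classifier X p)) (D : Measure (Datum X p)) : Prop :=
  (∀ f ∈ F, Measurable f) ∧
    ∀ (n : ℕ) (b : Fin n → Bool),
      NullMeasurableSet {S : Fin n → Datum X p | ∃ f ∈ F, ∀ i, predict f (S i) = b i}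
        (Measure.pi fun _ => D)

/-- The predictive error `Pr_D[f(X,Z) ≠ Y]`. -/
def err (D : Measure (Datum X p)) (f : Classifier X p) : ℝ :=
  D.real {w | predict f w ≠ w.2.1}

/-- The event `E(f)`. -/
def MetricEvent.at (E : MetricEvent X p) (f : Classifier X p) : Set (Datum X p) :=
  {w | (predict f w, w) ∈ E}

/-- The event `Z = ℓ`. -/
def group (ℓ : Fin p) : Set (Datum X p) := {w | w.2.2 = ℓ}

/-- The joint probability `Pr_D[E(f), E'(f), Z = ℓ]`. -/
def joint (D : Measure (Datum X p)) (E E' : MetricEvent X p) (f : Classifier X p) (ℓ : Fin p) : ℝ :=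
  D.real (E.at f ∩ E'.at f ∩ group ℓ)

/-- The performance `q_ℓ(f) = Pr_D[E(f) | E'(f), Z = ℓ]` (equal to `0` if the condition has
probability `0`). -/
def performance (D : Measure (Datum X p)) (E E' : MetricEvent X p) (f : Classifier X p)
    (ℓ : Fin p) : ℝ :=
  (cond D (E'.at f ∩ group ℓ)).real (E.at f)

/-- The fairness metric `Ω_D(f) = min_ℓ q_ℓ(f) / max_ℓ q_ℓ(f)`. -/
def fairness (D : Measure (Datum X p)) (E E' : MetricEvent X p) (f : Classifier X p) : ℝ :=
  (⨅ ℓ, performance D E E' f ℓ) / (⨆ ℓ, performance D E E' f ℓ)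

/-- `f` is an optimal fair classifier: it minimizes `Err_D` over the `f ∈ F` with `Ω_D(f) ≥ τ`. -/
def IsOptimalFair (F : Set (Classifier X p)) (D : Measure (Datum X p)) (E E' : MetricEvent X p)
    (τ : ℝ) (f : Classifier X p) : Prop :=
  (f ∈ F ∧ τ ≤ fairness D E E' f) ∧
    ∀ g ∈ F, τ ≤ fairness D E E' g → err D f ≤ err D g

/-- The empirical distribution of `N` samples. -/
def empirical {N : ℕ} (S : Fin N → Datum X p) : Measure (Datum X p) :=
  (N : ENNReal)⁻¹ • ∑ i, Measure.dirac (S i)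

/-- `f` is feasible for the error-tolerant program with parameters `τ, η, lam, Δ` on the
samples `S`. -/
def ETFeasible (F : Set (Classifier X p)) (E E' : MetricEvent X p) (τ η lam Δ : ℝ) {N : ℕ}
    (S : Fin N → Datum X p) (f : Classifier X p) : Prop :=
  f ∈ F ∧
    τ * ((1 - (η + Δ) / lam) / (1 + (η + Δ) / lam)) ^ 2 ≤ fairness (empirical S) E E' f ∧
    ∀ ℓ, lam - η - Δ ≤ joint (empirical S) E E' f ℓ

/-- `f` is an optimal solution of the error-tolerant program on the samples `S`. -/
def ETOptimal (F : Set (Classifier X p)) (E E' : MetricEvent X p) (τ η lam Δ : ℝ) {N : ℕ}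
    (S : Fin N → Datum X p) (f : Classifier X p) : Prop :=
  ETFeasible F E E' τ η lam Δ S f ∧
    ∀ g, ETFeasible F E E' τ η lam Δ S g → err (empirical S) f ≤ err (empirical S) g

end

/-- `T` arises from `S` by changing the protected attributes of at most `η N` samples. -/
def HammingPerturbation {X : Type*} {p N : ℕ} (η : ℝ) (S T : Fin N → Datum X p) : Prop :=
  (∀ i, (T i).1 = (S i).1 ∧ (T i).2.1 = (S i).2.1) ∧
    ((Finset.univ.filter fun i => (T i).2.2 ≠ (S i).2.2).card : ℝ) ≤ η * N

/-- A randomized adversary of the `η`-Hamming model on `N` samples: for each outcome `r` of its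
internal randomness it maps the true samples to an admissible perturbation of them. -/
def IsHammingAdversary {R X : Type*} {p N : ℕ} (η : ℝ)
    (A : R → (Fin N → Datum X p) → (Fin N → Datum X p)) : Prop :=
  ∀ r S, HammingPerturbation η S (A r S)

end FairLearning

/-! Everything follows from one event about the clean samples: for all `f ∈ F` at once, the
frequencies of the `2p + 1` events behind `err`, `joint` and the denominators of `performance` lie
within `Δ` of their probabilities. An adversary changing at most `ηN` attributes shifts any
frequency by at most `η`, deterministically, so on this event the perturbed empirical distribution
is `(η + Δ)`-close to `D`, whatever the adversary does.

Uniform closeness is the Vapnik–Chervonenkis inequality `measure_exists_sampleCount_deviation_le`: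
compare with a ghost sample, swap paired points at random, and apply Hoeffding to each of the
polynomially many patterns allowed by Sauer–Shelah.

Given closeness, `etOptimal_guarantee` is deterministic. An additive error on probabilities bounded
below is a multiplicative error on `fairness` (`fairness_perturbation`). From `D` to the empirical
distribution this makes `fstar` feasible, so an optimum has error at most `2(η + Δ)` above it. In
the reverse direction the joint constraints supply the lower bound, and `loss_factor_ge` bounds the
total loss of fairness. -/

namespace FairLearning

/-! ### Exchangeability and Rademacher sums -/

/-- Permuting or relabelling the coordinates preserves a product of copies of one measure. -/
theorem measurePreserving_comp_equiv {Ω ι κ : Type*} [MeasurableSpace Ω] [Fintype ι] [Fintype κ]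
    (μ : Measure Ω) [SigmaFinite μ] (e : κ ≃ ι) :
    MeasurePreserving (fun (S : ι → Ω) (k : κ) => S (e k))
      (Measure.pi fun _ : ι => μ) (Measure.pi fun _ : κ => μ) := by
  have h := measurePreserving_piCongrLeft (α := fun _ : κ => Ω) (fun _ : κ => μ) e.symm
  convert h using 1
  funext S k
  have := MeasurableEquiv.piCongrLeft_apply_apply (β := fun _ : κ => Ω) e.symm S (e k)
  simpa using this.symm

/-- The moment generating function of a Rademacher sum with coefficients in `[-1, 1]`. -/
theorem sum_exp_rademacher_le {n : ℕ} (u : Fin n → ℝ) (hu : ∀ i, |u i| ≤ 1) (c : ℝ) :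
    ∑ s : Fin n → Bool, Real.exp (c * ∑ i, (if s i then -u i else u i)) ≤
      2 ^ n * Real.exp (n * c ^ 2 / 2) := by
  have h1 : ∀ s : Fin n → Bool, Real.exp (c * ∑ i, (if s i then -u i else u i)) =
      ∏ i, Real.exp (c * (if s i then -u i else u i)) := by
    intro s
    rw [Finset.mul_sum, Real.exp_sum]
  simp_rw [h1]
  rw [← Fintype.prod_sum (fun i (b : Bool) => Real.exp (c * (if b then -u i else u i)))]
  have h2 : ∀ i, ∑ b : Bool, Real.exp (c * (if b then -u i else u i)) ≤
      2 * Real.exp (c ^ 2 / 2) := by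
    intro i
    have h3 : ∑ b : Bool, Real.exp (c * (if b then -u i else u i)) = 2 * Real.cosh (c * u i) := by
      rw [Real.cosh_eq]; simp; ring
    rw [h3]
    have h4 : (c * u i) ^ 2 ≤ c ^ 2 := by
      have : (u i) ^ 2 ≤ 1 := by rw [← sq_abs]; nlinarith [hu i, abs_nonneg (u i)]
      rw [mul_pow]; nlinarith [sq_nonneg c]
    have := Real.cosh_le_exp_half_sq (c * u i)
    have h5 : Real.exp ((c * u i) ^ 2 / 2) ≤ Real.exp (c ^ 2 / 2) := Real.exp_le_exp.2 (by linarith)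
    linarith
  calc _ ≤ ∏ _i : Fin n, 2 * Real.exp (c ^ 2 / 2) :=
        Finset.prod_le_prod (fun i _ => Finset.sum_nonneg fun _ _ => (Real.exp_pos _).le)
          (fun i _ => h2 i)
    _ = _ := by
        rw [Finset.prod_const, mul_pow, ← Real.exp_nat_mul]
        simp; ring_nf

/-- Hoeffding's inequality for a Rademacher sum, one-sided, in counting form. -/
theorem card_rademacher_gt_le {n : ℕ} (u : Fin n → ℝ) (hu : ∀ i, |u i| ≤ 1) {a : ℝ} (ha : 0 ≤ a) :
    ((Finset.univ.filter fun s : Fin n → Bool =>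
      n * a < ∑ i, (if s i then -u i else u i)).card : ℝ) ≤
      2 ^ n * Real.exp (-(n * a ^ 2 / 2)) := by
  set Q := Finset.univ.filter fun s : Fin n → Bool => n * a < ∑ i, (if s i then -u i else u i)
  -- Exponential Markov inequality with parameter `c = a`, the minimizer of `n c² / 2 - n a c`.
  have h : (Q.card : ℝ) * Real.exp (n * a ^ 2) ≤ 2 ^ n * Real.exp (n * a ^ 2 / 2) := by
    calc (Q.card : ℝ) * Real.exp (n * a ^ 2) = ∑ s ∈ Q, Real.exp (n * a ^ 2) := by simp
      _ ≤ ∑ s ∈ Q, Real.exp (a * ∑ i, (if s i then -u i else u i)) := by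
          refine Finset.sum_le_sum fun s hs => Real.exp_le_exp.2 ?_
          have := (Finset.mem_filter.1 hs).2
          nlinarith
      _ ≤ ∑ s : Fin n → Bool, Real.exp (a * ∑ i, (if s i then -u i else u i)) :=
          Finset.sum_le_sum_of_subset_of_nonneg (Finset.subset_univ _)
            fun _ _ _ => (Real.exp_pos _).le
      _ ≤ _ := sum_exp_rademacher_le u hu a
  calc (Q.card : ℝ) = Q.card * Real.exp (n * a ^ 2) * Real.exp (-(n * a ^ 2)) := by
        rw [mul_assoc, ← Real.exp_add]; simp
    _ ≤ 2 ^ n * Real.exp (n * a ^ 2 / 2) * Real.exp (-(n * a ^ 2)) := by gcongr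
    _ = _ := by rw [mul_assoc, ← Real.exp_add]; ring_nf

/-- Hoeffding's inequality for a Rademacher sum, two-sided, in counting form. -/
theorem card_rademacher_abs_gt_le {n : ℕ} (u : Fin n → ℝ) (hu : ∀ i, |u i| ≤ 1) {a : ℝ}
    (ha : 0 ≤ a) :
    ((Finset.univ.filter fun s : Fin n → Bool =>
      n * a < |∑ i, (if s i then -u i else u i)|).card : ℝ) ≤
      2 * (2 ^ n * Real.exp (-(n * a ^ 2 / 2))) := by
  have h1 := card_rademacher_gt_le u hu ha
  have h2 := card_rademacher_gt_le (fun i => -u i) (by simpa using hu) ha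
  have h3 : (Finset.univ.filter fun s : Fin n → Bool =>
      n * a < |∑ i, (if s i then -u i else u i)|) ⊆
      (Finset.univ.filter fun s : Fin n → Bool => n * a < ∑ i, (if s i then -u i else u i)) ∪
      (Finset.univ.filter fun s : Fin n → Bool =>
        n * a < ∑ i, (if s i then -(-u i) else -u i)) := by
    intro s hs
    simp only [Finset.mem_filter, Finset.mem_univ, true_and, Finset.mem_union] at hs ⊢
    rcases lt_abs.1 hs with h | h
    · exact Or.inl h
    · right
      rw [← Finset.sum_neg_distrib] at h
      refine h.trans_le (Finset.sum_le_sum fun i _ => ?_)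
      split_ifs <;> simp
  have h4 := (Finset.card_le_card h3).trans (Finset.card_union_le _ _)
  have h5 := (Nat.cast_le (α := ℝ)).2 h4
  push_cast at h5
  linarith

/-! ### The Vapnik–Chervonenkis inequality -/

/-- The number of sample points that lie in `C`. -/
noncomputable def sampleCount {Ω ι : Type*} [Fintype ι] (C : Set Ω) (S : ι → Ω) : ℝ :=
  ∑ i, C.indicator (fun _ => (1 : ℝ)) (S i)

/-- The patterns that a family of sets cuts out of a sample. -/
def tracePatterns {Ω ι : Type*} (𝒞 : Set (Set Ω)) (T : ι → Ω) : Set (ι → Bool) :=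
  {b | ∃ C ∈ 𝒞, ∀ i, T i ∈ C ↔ b i = true}

/-- Chebyshev's inequality for the empirical frequency of a single set. -/
theorem measure_sampleCount_deviation_le {Ω : Type*} [MeasurableSpace Ω] (μ : Measure Ω)
    [IsProbabilityMeasure μ] {C : Set Ω} (hC : MeasurableSet C) {n : ℕ} {t : ℝ} (ht : 0 < t)
    (hn : 2 ≤ n * t ^ 2) :
    (Measure.pi fun _ : Fin n => μ) {S | n * (t / 2) ≤ |sampleCount C S - n * μ.real C|} ≤
      2⁻¹ := by
  have hn0 : (0 : ℝ) < n := by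
    rcases Nat.eq_zero_or_pos n with h | h
    · subst h; norm_num at hn
    · exact_mod_cast h
  set Y : Ω → ℝ := C.indicator (fun _ => (1 : ℝ)) with hY
  have hYm : Measurable Y := measurable_const.indicator hC
  have hYb : ∀ w, Y w ∈ Set.Icc (0 : ℝ) 1 := by
    intro w
    by_cases h : w ∈ C <;> simp [hY, h]
  have hYL : MemLp Y 2 μ := by
    refine MemLp.of_bound hYm.aestronglyMeasurable 1 (ae_of_all _ fun w => ?_)
    rw [Real.norm_eq_abs, abs_of_nonneg (hYb w).1]
    exact (hYb w).2
  have hYL' : ∀ i : Fin n, MemLp (fun S : Fin n → Ω => Y (S i)) 2 (Measure.pi fun _ : Fin n => μ) :=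
    fun i => hYL.comp_measurePreserving (measurePreserving_eval (fun _ : Fin n => μ) i)
  have hsum : (fun S : Fin n → Ω => sampleCount C S) = ∑ i, fun S : Fin n → Ω => Y (S i) := by
    funext S
    simp [sampleCount, hY, Finset.sum_apply]
  have hL : MemLp (fun S : Fin n → Ω => sampleCount C S) 2 (Measure.pi fun _ : Fin n => μ) := by
    rw [hsum]
    exact memLp_finsetSum' _ fun i _ => hYL' i
  have hvar : Var[fun S : Fin n → Ω => sampleCount C S; Measure.pi fun _ : Fin n => μ] ≤ n / 4 := by
    rw [hsum, variance_sum_pi (X := fun _ => Y) (fun _ => hYL)]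
    have := variance_le_sq_of_bounded (μ := μ) (ae_of_all _ hYb) hYm.aemeasurable
    simp only [Finset.sum_const, Finset.card_univ, Fintype.card_fin, nsmul_eq_mul]
    nlinarith
  have hmean : ∫ S, sampleCount C S ∂(Measure.pi fun _ : Fin n => μ) = n * μ.real C := by
    change ∫ S : Fin n → Ω, ∑ i, Y (S i) ∂(Measure.pi fun _ : Fin n => μ) = _
    rw [integral_finsetSum _ fun i _ => (hYL' i).integrable (by norm_num)]
    have : ∀ i : Fin n, ∫ S : Fin n → Ω, Y (S i)
        ∂(Measure.pi fun _ : Fin n => μ) = μ.real C := by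
      intro i
      rw [integral_comp_eval (μ := fun _ : Fin n => μ) (f := Y) hYm.aestronglyMeasurable]
      simp [hY, integral_indicator hC]
    simp [this]
  have h := meas_ge_le_variance_div_sq hL (c := n * (t / 2)) (by positivity)
  rw [hmean] at h
  refine h.trans ?_
  have : (2⁻¹ : ENNReal) = ENNReal.ofReal (2⁻¹ : ℝ) := by
    rw [ENNReal.ofReal_inv_of_pos (by norm_num)]; simp
  rw [this]
  refine ENNReal.ofReal_le_ofReal ?_
  -- Chebyshev gives `(n/4) / (n t/2)² = 1 / (n t²)`, which `hn` bounds by one half.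
  rw [div_le_iff₀ (by positivity)]
  nlinarith

/-- Swap the two copies of `i` for every `i` with `s i`. -/
def swapCopies {n : ℕ} (s : Fin n → Bool) : Fin n ⊕ Fin n ≃ Fin n ⊕ Fin n where
  toFun := Sum.elim (fun i => if s i then Sum.inr i else Sum.inl i)
    (fun i => if s i then Sum.inl i else Sum.inr i)
  invFun := Sum.elim (fun i => if s i then Sum.inr i else Sum.inl i)
    (fun i => if s i then Sum.inl i else Sum.inr i)
  left_inv := by rintro (i | i) <;> by_cases h : s i <;> simp [h]
  right_inv := by rintro (i | i) <;> by_cases h : s i <;> simp [h]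

/-- The two halves of the double sample `T` have frequencies differing by more than `a` on some
member of the family. -/
def halvesDeviate {Ω : Type*} (𝒞 : Set (Set Ω)) (n : ℕ) (a : ℝ) : Set (Fin n ⊕ Fin n → Ω) :=
  {T | ∃ C ∈ 𝒞, n * a < |∑ i, (C.indicator (fun _ => (1 : ℝ)) (T (Sum.inl i)) -
    C.indicator (fun _ => (1 : ℝ)) (T (Sum.inr i)))|}

/-- The difference of the two entries of a pattern over `i`. -/
def patternDiff {n : ℕ} (b : Fin n ⊕ Fin n → Bool) (i : Fin n) : ℝ :=
  (if b (Sum.inl i) then 1 else 0) - (if b (Sum.inr i) then 1 else 0)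

theorem abs_patternDiff_le {n : ℕ} (b : Fin n ⊕ Fin n → Bool) (i : Fin n) :
    |patternDiff b i| ≤ 1 := by
  unfold patternDiff
  split_ifs <;> simp

/-- This turns random swaps of paired sample points into Rademacher signs. -/
theorem patternDiff_swapCopies {n : ℕ} (b : Fin n ⊕ Fin n → Bool) (s : Fin n → Bool) (i : Fin n) :
    patternDiff (fun k => b (swapCopies s k)) i =
      if s i then -patternDiff b i else patternDiff b i := by
  by_cases h : s i <;> simp [patternDiff, swapCopies, h]

theorem indicator_one_eq_ite {Ω : Type*} {C : Set Ω} {w : Ω} {b : Bool} (h : w ∈ C ↔ b = true) :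
    C.indicator (fun _ => (1 : ℝ)) w = if b then 1 else 0 := by
  by_cases hw : w ∈ C
  · simp [hw, h.1 hw]
  · have : b = false := by simpa using fun hb => hw (h.2 hb)
    simp [hw, this]

/-- A deviation sees `C` only through its trace on `T`, so an infinite family reduces to finitely
many patterns, both for the union bound and for measurability. -/
theorem mem_halvesDeviate_iff {Ω : Type*} (𝒞 : Set (Set Ω)) {n : ℕ} (a : ℝ)
    (T : Fin n ⊕ Fin n → Ω) :
    T ∈ halvesDeviate 𝒞 n a ↔ ∃ b ∈ tracePatterns 𝒞 T, n * a < |∑ i, patternDiff b i| := by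
  classical
  constructor
  · rintro ⟨C, hC, h⟩
    refine ⟨fun k => decide (T k ∈ C), ⟨C, hC, fun i => by simp⟩, ?_⟩
    simpa [patternDiff, Set.indicator_apply] using h
  · rintro ⟨b, ⟨C, hC, hb⟩, h⟩
    refine ⟨C, hC, ?_⟩
    simp_rw [indicator_one_eq_ite (hb _)]
    exact h

theorem tracePatterns_comp_equiv {Ω ι : Type*} (𝒞 : Set (Set Ω)) (T : ι → Ω) (e : ι ≃ ι)
    {b : ι → Bool} (hb : b ∈ tracePatterns 𝒞 fun k => T (e k)) :
    (fun k => b (e.symm k)) ∈ tracePatterns 𝒞 T := by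
  obtain ⟨C, hC, h⟩ := hb
  exact ⟨C, hC, fun i => by simpa using h (e.symm i)⟩

theorem nullMeasurableSet_halvesDeviate {Ω : Type*} [MeasurableSpace Ω] {μ : Measure Ω}
    {𝒞 : Set (Set Ω)} {n : ℕ}
    (hm : ∀ b : Fin n ⊕ Fin n → Bool, NullMeasurableSet
      {T : Fin n ⊕ Fin n → Ω | b ∈ tracePatterns 𝒞 T} (Measure.pi fun _ => μ)) (a : ℝ) :
    NullMeasurableSet (halvesDeviate 𝒞 n a) (Measure.pi fun _ => μ) := by
  have : halvesDeviate 𝒞 n a = ⋃ b ∈ {b : Fin n ⊕ Fin n → Bool | n * a < |∑ i, patternDiff b i|},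
      {T : Fin n ⊕ Fin n → Ω | b ∈ tracePatterns 𝒞 T} := by
    ext T
    rw [mem_halvesDeviate_iff]
    simp only [Set.mem_iUnion, Set.mem_ofPred_eq, exists_prop]
    exact exists_congr fun b => and_comm
  rw [this]
  exact NullMeasurableSet.biUnion (Set.to_countable _) fun b _ => hm b

/-- For a fixed double sample, few sign vectors make the swapped halves deviate. -/
theorem card_swapCopies_halvesDeviate_le {Ω : Type*} {𝒞 : Set (Set Ω)} {n K : ℕ} {a : ℝ}
    (ha : 0 ≤ a) (T : Fin n ⊕ Fin n → Ω) (hK : (tracePatterns 𝒞 T).ncard ≤ K) :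
    ({s : Fin n → Bool | (fun k => T (swapCopies s k)) ∈ halvesDeviate 𝒞 n a}.ncard : ℝ) ≤
      K * (2 * (2 ^ n * Real.exp (-(n * a ^ 2 / 2)))) := by
  classical
  set B := (tracePatterns 𝒞 T).toFinset with hB
  have hBK : B.card ≤ K := by rwa [← Set.ncard_eq_toFinset_card']
  let Q : (Fin n ⊕ Fin n → Bool) → Finset (Fin n → Bool) := fun b =>
    Finset.univ.filter fun s => n * a < |∑ i, (if s i then -patternDiff b i else patternDiff b i)|
  have hsub : {s : Fin n → Bool | (fun k => T (swapCopies s k)) ∈ halvesDeviate 𝒞 n a} ⊆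
      (B.biUnion Q : Finset (Fin n → Bool)) := by
    intro s hs
    obtain ⟨b, hb, h⟩ := (mem_halvesDeviate_iff 𝒞 a fun k => T (swapCopies s k)).1 hs
    simp only [Finset.coe_biUnion, Set.mem_iUnion, Finset.mem_coe]
    -- Undoing the swap yields a pattern of `T` itself, so the union bound runs over a set of
    -- patterns independent of `s`.
    refine ⟨fun k => b ((swapCopies s).symm k), ?_, ?_⟩
    · simpa [hB] using tracePatterns_comp_equiv 𝒞 T (swapCopies s) hb
    · simp only [Q, Finset.mem_filter, Finset.mem_univ, true_and]
      simp_rw [← patternDiff_swapCopies]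
      simpa using h
  have h1 := Set.ncard_le_ncard hsub (Finset.finite_toSet _)
  rw [Set.ncard_coe_finset] at h1
  calc _ ≤ ((B.biUnion Q).card : ℝ) := by exact_mod_cast h1
    _ ≤ ∑ b ∈ B, ((Q b).card : ℝ) := by exact_mod_cast Finset.card_biUnion_le
    _ ≤ ∑ b ∈ B, (2 * (2 ^ n * Real.exp (-(n * a ^ 2 / 2)))) :=
        Finset.sum_le_sum fun b _ => card_rademacher_abs_gt_le _ (abs_patternDiff_le b) ha
    _ = B.card * (2 * (2 ^ n * Real.exp (-(n * a ^ 2 / 2)))) := by simp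
    _ ≤ _ := by gcongr

/-- Symmetrization by random swaps: a bound for the deviation between two independent samples. -/
theorem measure_halvesDeviate_le {Ω : Type*} [MeasurableSpace Ω] (μ : Measure Ω)
    [IsProbabilityMeasure μ] {𝒞 : Set (Set Ω)} {n K : ℕ} {a : ℝ} (ha : 0 ≤ a)
    (hm : ∀ b : Fin n ⊕ Fin n → Bool, NullMeasurableSet
      {T : Fin n ⊕ Fin n → Ω | b ∈ tracePatterns 𝒞 T} (Measure.pi fun _ => μ))
    (hK : ∀ T : Fin n ⊕ Fin n → Ω, (tracePatterns 𝒞 T).ncard ≤ K) :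
    (Measure.pi fun _ : Fin n ⊕ Fin n => μ) (halvesDeviate 𝒞 n a) ≤
      ENNReal.ofReal (K * (2 * Real.exp (-(n * a ^ 2 / 2)))) := by
  classical
  set ν := Measure.pi fun _ : Fin n ⊕ Fin n => μ with hν
  set H := halvesDeviate 𝒞 n a
  have hH : NullMeasurableSet H ν := nullMeasurableSet_halvesDeviate hm a
  let V : (Fin n → Bool) → Set (Fin n ⊕ Fin n → Ω) := fun s => {T | (fun k => T (swapCopies s k)) ∈ H}
  have hV : ∀ s, ν (V s) = ν H := fun s =>
    (measurePreserving_comp_equiv μ (swapCopies s)).measure_preimage hH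
  have hVm : ∀ s, NullMeasurableSet (V s) ν := fun s =>
    hH.preimage (measurePreserving_comp_equiv μ (swapCopies s)).quasiMeasurePreserving
  have hbound : ∀ T, ∑ s, (V s).indicator (1 : (Fin n ⊕ Fin n → Ω) → ENNReal) T ≤
      ENNReal.ofReal (K * (2 * (2 ^ n * Real.exp (-(n * a ^ 2 / 2))))) := by
    intro T
    have h1 : ∑ s, (V s).indicator (1 : (Fin n ⊕ Fin n → Ω) → ENNReal) T =
        ((Finset.univ.filter fun s => T ∈ V s).card : ENNReal) := by
      simp [Set.indicator_apply]
    have h2 := card_swapCopies_halvesDeviate_le ha T (hK T)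
    rw [Set.ncard_eq_toFinset_card'] at h2
    rw [h1, ← ENNReal.ofReal_natCast]
    refine ENNReal.ofReal_le_ofReal (le_trans (le_of_eq ?_) h2)
    congr 2
    ext s
    simp [V, H]
  -- Every swap preserves `ν`, so `2 ^ n * ν H` is the integral of the number of sign vectors that
  -- put `T` into `H`; that number is bounded pointwise.
  have hsum : (2 : ENNReal) ^ n * ν H ≤
      ENNReal.ofReal (K * (2 * (2 ^ n * Real.exp (-(n * a ^ 2 / 2))))) := by
    calc (2 : ENNReal) ^ n * ν H = ∑ s : Fin n → Bool, ν (V s) := by simp [hV]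
      _ = ∑ s : Fin n → Bool, ∫⁻ T, (V s).indicator 1 T ∂ν := by
          simp_rw [fun s => lintegral_indicator_one₀ (hVm s)]
      _ = ∫⁻ T, ∑ s : Fin n → Bool, (V s).indicator 1 T ∂ν := by
          rw [lintegral_finsetSum']
          exact fun s _ => (aemeasurable_const.indicator₀ (hVm s))
      _ ≤ ∫⁻ _T, ENNReal.ofReal (K * (2 * (2 ^ n * Real.exp (-(n * a ^ 2 / 2))))) ∂ν :=
          lintegral_mono hbound
      _ = _ := by simp [hν]
  have h2 : ENNReal.ofReal (K * (2 * (2 ^ n * Real.exp (-(n * a ^ 2 / 2))))) =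
      2 ^ n * ENNReal.ofReal (K * (2 * Real.exp (-(n * a ^ 2 / 2)))) := by
    rw [show (2 : ENNReal) ^ n = ENNReal.ofReal (2 ^ n) by
      rw [ENNReal.ofReal_pow (by norm_num)]; simp, ← ENNReal.ofReal_mul (by positivity)]
    ring_nf
  rw [h2] at hsum
  exact (ENNReal.mul_le_mul_iff_right (by simp) (by finiteness)).1 hsum

/-- The Vapnik–Chervonenkis inequality, for the outer measure: a family of measurable sets that cuts
at most `K` patterns out of any `2n` points has frequencies uniformly close to probabilities. -/
theorem measure_exists_sampleCount_deviation_le {Ω : Type*} [MeasurableSpace Ω] (μ : Measure Ω)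
    [IsProbabilityMeasure μ] {𝒞 : Set (Set Ω)} (h𝒞 : ∀ C ∈ 𝒞, MeasurableSet C) {n K : ℕ} {t : ℝ}
    (ht : 0 < t) (hn : 2 ≤ n * t ^ 2)
    (hm : ∀ b : Fin n ⊕ Fin n → Bool, NullMeasurableSet
      {T : Fin n ⊕ Fin n → Ω | b ∈ tracePatterns 𝒞 T} (Measure.pi fun _ => μ))
    (hK : ∀ T : Fin n ⊕ Fin n → Ω, (tracePatterns 𝒞 T).ncard ≤ K) :
    (Measure.pi fun _ : Fin n => μ)
        {S | ∃ C ∈ 𝒞, n * t < |sampleCount C S - n * μ.real C|} ≤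
      ENNReal.ofReal (4 * K * Real.exp (-(n * t ^ 2 / 8))) := by
  set π := Measure.pi fun _ : Fin n => μ with hπ
  set H := halvesDeviate 𝒞 n (t / 2) with hHdef
  have hH := measure_halvesDeviate_le μ (a := t / 2) (by positivity) hm hK
  rw [← hHdef] at hH
  have hHm : NullMeasurableSet H (Measure.pi fun _ : Fin n ⊕ Fin n => μ) :=
    nullMeasurableSet_halvesDeviate hm _
  have hmp := measurePreserving_sumPiEquivProdPi_symm (X := fun _ : Fin n ⊕ Fin n => Ω)
    (fun _ => μ)
  have hpre := hmp.measure_preimage hHm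
  set H' := (MeasurableEquiv.sumPiEquivProdPi fun _ : Fin n ⊕ Fin n => Ω).symm ⁻¹' H with hH'
  rw [← hπ] at hpre
  -- A measurable hull keeps the measure of `H'` and makes the measure of its sections a measurable
  -- function, as Markov's inequality requires.
  set M := toMeasurable (π.prod π) H'
  have hM : MeasurableSet M := measurableSet_toMeasurable _ _
  -- Ghost sample: if `S` is off by more than `n t` on `C`, then with probability at least one half
  -- an independent `S'` is off by less than `n t / 2` on the same `C`, and the two halves differ by
  -- more than `n t / 2`.
  have hsec : ∀ S, (∃ C ∈ 𝒞, n * t < |sampleCount C S - n * μ.real C|) →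
      2⁻¹ ≤ π (Prod.mk S ⁻¹' M) := by
    rintro S ⟨C, hC, hS⟩
    have h1 := measure_sampleCount_deviation_le μ (h𝒞 C hC) ht hn
    rw [← hπ] at h1
    have h2 : {S' : Fin n → Ω | n * (t / 2) ≤ |sampleCount C S' - n * μ.real C|}ᶜ ⊆
        Prod.mk S ⁻¹' M := by
      intro S' hS'
      refine subset_toMeasurable _ _ ?_
      simp only [Set.mem_compl_iff, Set.mem_ofPred_eq, not_le] at hS'
      refine ⟨C, hC, ?_⟩
      have h3 : ∑ i : Fin n, (C.indicator (fun _ => (1 : ℝ)) (S i) -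
          C.indicator (fun _ => (1 : ℝ)) (S' i)) = (sampleCount C S - n * μ.real C) -
          (sampleCount C S' - n * μ.real C) := by
        rw [Finset.sum_sub_distrib]; simp [sampleCount]
      have h4 := abs_sub_abs_le_abs_sub (sampleCount C S - n * μ.real C)
        (sampleCount C S' - n * μ.real C)
      rw [← h3] at h4
      refine lt_of_lt_of_le ?_ h4
      linarith
    have h5 := measure_univ_le_add_compl (μ := π)
      {S' : Fin n → Ω | n * (t / 2) ≤ |sampleCount C S' - n * μ.real C|}
    have h6 : (1 : ENNReal) ≤ 2⁻¹ + π (Prod.mk S ⁻¹' M) := by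
      calc (1 : ENNReal) = π Set.univ := by simp [hπ]
        _ ≤ _ := h5
        _ ≤ _ := add_le_add h1 (measure_mono h2)
    rw [← ENNReal.inv_two_add_inv_two] at h6
    exact (ENNReal.add_le_add_iff_left (by simp)).1 h6
  have hmarkov := mul_meas_ge_le_lintegral (μ := π) (measurable_measure_prodMk_left (ν := π) hM) 2⁻¹
  rw [← Measure.prod_apply hM, measure_toMeasurable, hpre] at hmarkov
  have h7 : 2⁻¹ * π {S | ∃ C ∈ 𝒞, n * t < |sampleCount C S - n * μ.real C|} ≤
      ENNReal.ofReal (K * (2 * Real.exp (-(n * (t / 2) ^ 2 / 2)))) :=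
    (mul_le_mul_right (measure_mono hsec) _).trans (hmarkov.trans hH)
  have h8 : ENNReal.ofReal (4 * K * Real.exp (-(n * t ^ 2 / 8))) =
      2 * ENNReal.ofReal (K * (2 * Real.exp (-(n * (t / 2) ^ 2 / 2)))) := by
    rw [show (2 : ENNReal) = ENNReal.ofReal 2 by simp, ← ENNReal.ofReal_mul (by norm_num)]
    ring_nf
  rw [h8]
  calc _ = 2 * (2⁻¹ * π {S | ∃ C ∈ 𝒞, n * t < |sampleCount C S - n * μ.real C|}) := by
        rw [← mul_assoc, ENNReal.mul_inv_cancel (by simp) (by simp), one_mul]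
    _ ≤ _ := mul_le_mul_right h7 _

/-! ### Sauer–Shelah for classifiers on samples -/

/-- Termwise comparison with the binomial expansion of `(m + 1) ^ d`: `m.choose k ≤ m ^ k ≤ m ^ k *
d.choose k`. -/
theorem sum_choose_le_pow (m d : ℕ) : ∑ k ∈ Finset.Iic d, m.choose k ≤ (m + 1) ^ d := by
  rw [add_pow, Nat.range_succ_eq_Iic]
  refine Finset.sum_le_sum fun k hk => ?_
  have h1 : 0 < d.choose k := Nat.choose_pos (Finset.mem_Iic.1 hk)
  have h2 : m.choose k ≤ m ^ k := Nat.choose_le_pow m k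
  simpa using h2.trans (Nat.le_mul_of_pos_right _ h1)

/-- The Sauer–Shelah bound on the number of prediction patterns of `F` on a sample. -/
theorem HasVCDim.ncard_predictions_le {X : Type*} {p d : ℕ} {F : Set (Classifier X p)}
    (hF : HasVCDim F d) {ι : Type*} [Fintype ι] (T : ι → Datum X p) :
    {b : ι → Bool | ∃ f ∈ F, ∀ i, predict f (T i) = b i}.ncard ≤ (Fintype.card ι + 1) ^ d := by
  classical
  let toSet : (ι → Bool) → Finset ι := fun b => Finset.univ.filter fun i => b i = true
  have hinj : Function.Injective toSet := by
    intro b c h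
    funext i
    have := congrArg (i ∈ ·) h
    simpa [toSet, ← Bool.eq_iff_iff] using this
  set 𝒜 := ({b : ι → Bool | ∃ f ∈ F, ∀ i, predict f (T i) = b i}.toFinset).image toSet with h𝒜
  have hcard : {b : ι → Bool | ∃ f ∈ F, ∀ i, predict f (T i) = b i}.ncard = 𝒜.card := by
    rw [h𝒜, Finset.card_image_of_injective _ hinj, Set.ncard_eq_toFinset_card']
  have hmem : ∀ u ∈ 𝒜, ∃ f ∈ F, ∀ i, predict f (T i) = true ↔ i ∈ u := by
    intro u hu
    obtain ⟨b, hb, rfl⟩ := Finset.mem_image.1 hu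
    obtain ⟨f, hf, h⟩ := by simpa using hb
    exact ⟨f, hf, fun i => by simp [toSet, h]⟩
  let φ : ι → X × Fin p := fun i => ((T i).1, (T i).2.2)
  have hvc : 𝒜.vcDim ≤ d := by
    refine Finset.sup_le fun s hs => ?_
    have hs := Finset.mem_shatterer.1 hs
    -- Indices with equal image under `φ` always receive the same prediction, so a shattered index
    -- set contains no two of them; it therefore maps to a shattered set of the same size.
    have hφ : Set.InjOn φ s := by
      intro i hi j hj hij
      obtain ⟨u, hu, hsu⟩ := hs (Finset.singleton_subset_iff.2 hi)
      obtain ⟨f, -, hf⟩ := hmem u hu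
      have hiu : i ∈ u := (Finset.mem_inter.1 (hsu ▸ Finset.mem_singleton_self i)).2
      have hju : j ∈ u := (hf j).1 (by
        have := (hf i).2 hiu
        unfold predict at this ⊢
        change f (φ i) = true at this
        change f (φ j) = true
        rwa [← hij])
      have : j ∈ s ∩ u := Finset.mem_inter.2 ⟨hj, hju⟩
      rw [hsu] at this
      exact (Finset.mem_singleton.1 this).symm
    refine hF.2 ⟨s.image φ, Finset.card_image_of_injOn hφ, ?_⟩
    intro B hB
    obtain ⟨u, hu, hsu⟩ := hs (Finset.filter_subset (fun i => φ i ∈ B) s)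
    obtain ⟨f, hfF, hf⟩ := hmem u hu
    refine ⟨f, hfF, fun a ha => ?_⟩
    obtain ⟨i, hi, rfl⟩ := Finset.mem_image.1 ha
    have h1 : f (φ i) = true ↔ i ∈ u := hf i
    rw [h1]
    have h2 : i ∈ s ∩ u ↔ φ i ∈ B := by rw [hsu]; simp [hi]
    rw [← h2]; simp [hi]
  rw [hcard]
  calc 𝒜.card ≤ _ := 𝒜.card_le_card_shatterer
    _ ≤ ∑ k ∈ Finset.Iic 𝒜.vcDim, (Fintype.card ι).choose k := Finset.card_shatterer_le_sum_vcDim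
    _ ≤ ∑ k ∈ Finset.Iic d, (Fintype.card ι).choose k :=
        Finset.sum_le_sum_of_subset (Finset.Iic_subset_Iic.2 hvc)
    _ ≤ _ := sum_choose_le_pow _ _

/-! ### Event families and Hamming perturbations -/

section

variable {X : Type*} {p : ℕ}

/-- The events `G(f)` for `f ∈ F`. -/
def eventFamily (F : Set (Classifier X p)) (G : MetricEvent X p) : Set (Set (Datum X p)) :=
  {C | ∃ f ∈ F, C = G.at f}

/-- The misprediction event. -/
def errEvent : MetricEvent X p := {q | q.1 ≠ q.2.2.1}

/-- The joint event `E, Z = ℓ`. -/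
def groupEvent (E : MetricEvent X p) (ℓ : Fin p) : MetricEvent X p := E ∩ {q | q.2.2.2 = ℓ}

/-- On a fixed sample the trace of `G.at f` is a function of the predictions of `f`, so no event
family has more patterns than `F`. -/
theorem ncard_tracePatterns_eventFamily_le {F : Set (Classifier X p)} {d : ℕ} (hF : HasVCDim F d)
    (G : MetricEvent X p) {ι : Type*} [Fintype ι] (T : ι → Datum X p) :
    (tracePatterns (eventFamily F G) T).ncard ≤ (Fintype.card ι + 1) ^ d := by
  classical
  have hsub : tracePatterns (eventFamily F G) T ⊆
      Set.image (fun b : ι → Bool => fun i => decide ((b i, T i) ∈ G))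
        {b : ι → Bool | ∃ f ∈ F, ∀ i, predict f (T i) = b i} := by
    rintro b ⟨C, ⟨f, hf, rfl⟩, hb⟩
    refine ⟨fun i => predict f (T i), ⟨f, hf, fun i => rfl⟩, ?_⟩
    funext i
    rw [Bool.eq_iff_iff, ← hb i]
    simp [MetricEvent.at]
  exact (Set.ncard_le_ncard hsub (Set.toFinite _)).trans
    ((Set.ncard_image_le (Set.toFinite _)).trans (hF.ncard_predictions_le T))

/-- An unchanged sample contributes nothing to the difference, and a changed one at most 1. -/
theorem HammingPerturbation.abs_sampleCount_sub_le {N : ℕ} {η : ℝ} {S T : Fin N → Datum X p}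
    (h : HammingPerturbation η S T) (C : Set (Datum X p)) :
    |sampleCount C T - sampleCount C S| ≤ η * N := by
  refine le_trans ?_ h.2
  unfold sampleCount
  rw [← Finset.sum_sub_distrib, Finset.card_filter]
  push_cast
  refine (Finset.abs_sum_le_sum_abs _ _).trans (Finset.sum_le_sum fun i _ => ?_)
  by_cases hz : (T i).2.2 = (S i).2.2
  · have : T i = S i := Prod.ext (h.1 i).1 (Prod.ext (h.1 i).2 hz)
    simp [this]
  · by_cases h1 : T i ∈ C <;> by_cases h2 : S i ∈ C <;> simp [h1, h2, hz]

end

/-! ### Elementary estimates for ratios -/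

/-- Additive perturbations of numerator and denominator change a ratio by a bounded factor. -/
theorem ratio_perturbation {m e a b a' b' : ℝ} (hm : 0 < m) (he : 0 ≤ e) (hem : e < m)
    (hma : m ≤ a) (hab : a ≤ b) (ha : |a' - a| ≤ e) (hb : |b' - b| ≤ e) :
    (m - e) / (m + e) * (a / b) ≤ a' / b' ∧ (m - e) / (m + e) * (a' / b') ≤ a / b := by
  obtain ⟨ha1, ha2⟩ := abs_le.1 ha
  obtain ⟨hb1, hb2⟩ := abs_le.1 hb
  have hb0 : 0 < b := by linarith
  have hb'0 : 0 < b' := by linarith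
  have ha'0 : 0 < a' := by linarith
  -- Since `a, b ≥ m`, the additive error `e` is at most the fraction `e / m` of `a` and of `b`.
  have hea : e * m ≤ e * a := mul_le_mul_of_nonneg_left hma he
  have heb : e * m ≤ e * b := mul_le_mul_of_nonneg_left (hma.trans hab) he
  have h1 : (m - e) * a ≤ m * a' := by nlinarith
  have h2 : m * b' ≤ (m + e) * b := by nlinarith
  have h3 : m * a' ≤ (m + e) * a := by nlinarith
  have h4 : (m - e) * b ≤ m * b' := by nlinarith
  constructor
  · rw [div_mul_div_comm, div_le_div_iff₀ (by positivity) hb'0]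
    refine le_of_mul_le_mul_left (a := m) ?_ hm
    calc m * ((m - e) * a * b') = ((m - e) * a) * (m * b') := by ring
      _ ≤ (m * a') * ((m + e) * b) := mul_le_mul h1 h2 (by positivity) (by positivity)
      _ = _ := by ring
  · rw [div_mul_div_comm, div_le_div_iff₀ (by positivity) hb0]
    refine le_of_mul_le_mul_left (a := m) ?_ hm
    calc m * ((m - e) * a' * b) = ((m - e) * b) * (m * a') := by ring
      _ ≤ (m * b') * ((m + e) * a) := mul_le_mul h4 h3 (by positivity) (by positivity)
      _ = _ := by ring

/-- The loss factor of passing from the true to the empirical distribution and back. -/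
theorem loss_factor_ge {lam e : ℝ} (hlam : 0 < lam) (he : 0 ≤ e) (h2e : 2 * e < lam) :
    1 - 8 * e / lam ≤ ((lam - e - e) / (lam - e + e)) ^ 2 *
      ((1 - e / lam) / (1 + e / lam)) ^ 2 := by
  set x := e / lam with hx
  have hx0 : 0 ≤ x := div_nonneg he hlam.le
  have hx1 : 2 * x < 1 := by rw [hx, ← mul_div_assoc, div_lt_one hlam]; exact h2e
  -- With `(1 - x)/(1 + x) ≥ 1 - 2x`, the whole product is at least `(1 - 2x)⁴`, and Bernoulli gives
  -- `1 - 8x`.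
  have h1 : (lam - e - e) / (lam - e + e) = 1 - 2 * x := by
    rw [hx, sub_add_cancel]; field_simp; ring
  have h2 : 1 - 2 * x ≤ (1 - x) / (1 + x) := by
    rw [le_div_iff₀ (by linarith)]; nlinarith
  have h3 : (1 - 2 * x) ^ 2 ≤ ((1 - x) / (1 + x)) ^ 2 := by
    gcongr
  rw [h1, mul_div_assoc, ← hx]
  have h4 : (1 - 2 * x) ^ 2 * (1 - 2 * x) ^ 2 ≤
      (1 - 2 * x) ^ 2 * ((1 - x) / (1 + x)) ^ 2 := by gcongr
  have h5 := one_add_mul_le_pow (a := -(2 * x)) (by linarith) 4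
  push_cast at h5
  nlinarith

/-! ### Measurability and empirical frequencies -/

section

variable {X : Type*} [MeasurableSpace X] {p : ℕ}

theorem measurable_predict {f : Classifier X p} (hf : Measurable f) : Measurable (predict f) := by
  have h : Measurable fun w : Datum X p => (w.1, w.2.2) := by fun_prop
  exact Measurable.comp hf h

theorem measurableSet_at {G : MetricEvent X p} (hG : MeasurableSet G) {f : Classifier X p}
    (hf : Measurable f) : MeasurableSet (G.at f) :=
  ((measurable_predict hf).prodMk measurable_id) hG

theorem IsMeasurableClass.nullMeasurableSet_predictions {F : Set (Classifier X p)}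
    {D : Measure (Datum X p)} [IsProbabilityMeasure D] (hF : IsMeasurableClass F D)
    {ι : Type*} [Fintype ι] (b : ι → Bool) :
    NullMeasurableSet {T : ι → Datum X p | ∃ f ∈ F, ∀ i, predict f (T i) = b i}
      (Measure.pi fun _ => D) := by
  let e := (Fintype.equivFin ι).symm
  have h := (hF.2 (Fintype.card ι) fun k => b (e k)).preimage
    (measurePreserving_comp_equiv D e).quasiMeasurePreserving
  convert h using 1
  ext T
  refine exists_congr fun f => and_congr_right fun _ => ?_
  exact (e.forall_congr_right (q := fun i => predict f (T i) = b i)).symm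

/-- Split by the prediction pattern `c`, of which there are finitely many: once `c` is fixed,
membership in `G` is a measurable condition on `T` not involving `f`. -/
theorem IsMeasurableClass.nullMeasurableSet_tracePatterns {F : Set (Classifier X p)}
    {D : Measure (Datum X p)} [IsProbabilityMeasure D] (hF : IsMeasurableClass F D)
    {G : MetricEvent X p} (hG : MeasurableSet G) {ι : Type*} [Fintype ι] (b : ι → Bool) :
    NullMeasurableSet {T : ι → Datum X p | b ∈ tracePatterns (eventFamily F G) T}
      (Measure.pi fun _ => D) := by
  have : {T : ι → Datum X p | b ∈ tracePatterns (eventFamily F G) T} = ⋃ c : ι → Bool,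
      ({T : ι → Datum X p | ∃ f ∈ F, ∀ i, predict f (T i) = c i} ∩
        ⋂ i, {T : ι → Datum X p | (c i, T i) ∈ G ↔ b i = true}) := by
    ext T
    simp only [Set.mem_iUnion, Set.mem_inter_iff, Set.mem_iInter, Set.mem_ofPred_eq]
    constructor
    · rintro ⟨C, ⟨f, hf, rfl⟩, hb⟩
      exact ⟨fun i => predict f (T i), ⟨f, hf, fun i => rfl⟩, hb⟩
    · rintro ⟨c, ⟨f, hf, hc⟩, hb⟩
      refine ⟨G.at f, ⟨f, hf, rfl⟩, fun i => ?_⟩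
      rw [← hb i, ← hc i]
      rfl
  rw [this]
  refine NullMeasurableSet.iUnion fun c => (hF.nullMeasurableSet_predictions c).inter ?_
  refine (MeasurableSet.iInter fun i => ?_).nullMeasurableSet
  have h1 : MeasurableSet {T : ι → Datum X p | (c i, T i) ∈ G} :=
    (measurable_const.prodMk (measurable_pi_apply i)) hG
  by_cases hb : b i = true
  · simpa [hb] using h1
  · have h2 : {T : ι → Datum X p | (c i, T i) ∈ G ↔ b i = true} =
        {T : ι → Datum X p | (c i, T i) ∈ G}ᶜ := by
      ext T; simp [hb]
    rw [h2]
    exact h1.compl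

theorem empirical_real {N : ℕ} (S : Fin N → Datum X p) {C : Set (Datum X p)}
    (hC : MeasurableSet C) : (empirical S).real C = sampleCount C S / N := by
  unfold empirical sampleCount
  rw [measureReal_ennreal_smul_apply, measureReal_def, Measure.finsetSum_apply,
    ENNReal.toReal_sum]
  · rw [ENNReal.toReal_inv, ENNReal.toReal_natCast, div_eq_inv_mul]
    congr 1
    refine Finset.sum_congr rfl fun i _ => ?_
    rw [Measure.dirac_apply' _ hC]
    by_cases h : S i ∈ C <;> simp [h]
  · intro i _
    exact measure_ne_top _ _

theorem HammingPerturbation.abs_empirical_sub_le {N : ℕ} (hN : 0 < N) {η Δ : ℝ}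
    {S T : Fin N → Datum X p} (h : HammingPerturbation η S T) {C : Set (Datum X p)}
    (hC : MeasurableSet C) {D : Measure (Datum X p)}
    (hS : |sampleCount C S - N * D.real C| ≤ N * Δ) :
    |(empirical T).real C - D.real C| ≤ η + Δ := by
  have hN' : (0 : ℝ) < N := by exact_mod_cast hN
  rw [empirical_real T hC]
  have h1 := h.abs_sampleCount_sub_le C
  have h2 : sampleCount C T / N - D.real C =
      ((sampleCount C T - sampleCount C S) + (sampleCount C S - N * D.real C)) / N := by
    field_simp; ring
  rw [h2, abs_div, abs_of_pos hN', div_le_iff₀ hN']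
  refine (abs_add_le _ _).trans ?_
  linarith

theorem measurableSet_errEvent : MeasurableSet (errEvent : MetricEvent X p) := by
  have : Measurable fun q : Bool × Datum X p => (q.1, q.2.2.1) := by fun_prop
  exact this (MeasurableSet.of_discrete (s := {r : Bool × Bool | r.1 ≠ r.2}))

theorem measurableSet_groupEvent {E : MetricEvent X p} (hE : MeasurableSet E) (ℓ : Fin p) :
    MeasurableSet (groupEvent E ℓ) := by
  have : Measurable fun q : Bool × Datum X p => q.2.2.2 := by fun_prop
  exact hE.inter (this (measurableSet_singleton ℓ))

theorem measurableSet_group (ℓ : Fin p) : MeasurableSet (group ℓ : Set (Datum X p)) := by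
  have : Measurable fun q : Datum X p => q.2.2 := by fun_prop
  exact this (measurableSet_singleton ℓ)

theorem err_eq (D : Measure (Datum X p)) (f : Classifier X p) :
    err D f = D.real (errEvent.at f) := rfl

theorem joint_eq (D : Measure (Datum X p)) (E E' : MetricEvent X p) (f : Classifier X p)
    (ℓ : Fin p) : joint D E E' f ℓ = D.real ((groupEvent (E ∩ E') ℓ).at f) := rfl

theorem performance_eq (D : Measure (Datum X p)) (E E' : MetricEvent X p)
    (hE' : MeasurableSet E') {f : Classifier X p} (hf : Measurable f) (ℓ : Fin p) :
    performance D E E' f ℓ = joint D E E' f ℓ / D.real ((groupEvent E' ℓ).at f) := by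
  unfold performance joint
  rw [measureReal_def, cond_apply ((measurableSet_at hE' hf).inter (measurableSet_group ℓ)),
    ENNReal.toReal_mul, ENNReal.toReal_inv, div_eq_inv_mul,
    show E'.at f ∩ group ℓ ∩ E.at f = E.at f ∩ E'.at f ∩ group ℓ by
      ext w; simp only [Set.mem_inter_iff]; tauto]
  rfl

/-! ### Stability of fairness and the deterministic guarantee -/

/-- The fairness metric is stable under small changes of the distribution. -/
theorem fairness_perturbation [Nonempty (Fin p)] {P Q : Measure (Datum X p)} [IsFiniteMeasure P]
    {E E' : MetricEvent X p} (hE' : MeasurableSet E') {f : Classifier X p} (hf : Measurable f)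
    {m e : ℝ} (hm : 0 < m) (he : 0 ≤ e) (hem : e < m) (hP : ∀ ℓ, m ≤ joint P E E' f ℓ)
    (hj : ∀ ℓ, |joint Q E E' f ℓ - joint P E E' f ℓ| ≤ e)
    (hc : ∀ ℓ, |Q.real ((groupEvent E' ℓ).at f) - P.real ((groupEvent E' ℓ).at f)| ≤ e) :
    ((m - e) / (m + e)) ^ 2 * fairness P E E' f ≤ fairness Q E E' f := by
  set r := (m - e) / (m + e) with hr
  have hr0 : 0 < r := div_pos (by linarith) (by linarith)
  have hjc : ∀ ℓ, joint P E E' f ℓ ≤ P.real ((groupEvent E' ℓ).at f) := by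
    intro ℓ
    rw [joint_eq]
    refine measureReal_mono ?_
    rintro w ⟨⟨-, h1⟩, h2⟩
    exact ⟨h1, h2⟩
  -- One factor `r` is lost in the minimum and one in the maximum, hence the square.
  have hratio : ∀ ℓ, r * performance P E E' f ℓ ≤ performance Q E E' f ℓ ∧
      r * performance Q E E' f ℓ ≤ performance P E E' f ℓ := by
    intro ℓ
    rw [performance_eq P E E' hE' hf, performance_eq Q E E' hE' hf]
    exact ratio_perturbation hm he hem (hP ℓ) (hjc ℓ) (hj ℓ) (hc ℓ)
  have hPpos : ∀ ℓ, 0 < performance P E E' f ℓ := by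
    intro ℓ
    rw [performance_eq P E E' hE' hf]
    exact div_pos (hm.trans_le (hP ℓ)) (hm.trans_le ((hP ℓ).trans (hjc ℓ)))
  have bbP := (Set.finite_range (performance P E E' f)).bddBelow
  have baP := (Set.finite_range (performance P E E' f)).bddAbove
  have baQ := (Set.finite_range (performance Q E E' f)).bddAbove
  obtain ⟨ℓ₀⟩ := ‹Nonempty (Fin p)›
  have hsupP : 0 < ⨆ ℓ, performance P E E' f ℓ := (hPpos ℓ₀).trans_le (le_ciSup baP ℓ₀)
  have hQpos : 0 < performance Q E E' f ℓ₀ :=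
    (mul_pos hr0 (hPpos ℓ₀)).trans_le (hratio ℓ₀).1
  have hsupQ : 0 < ⨆ ℓ, performance Q E E' f ℓ := hQpos.trans_le (le_ciSup baQ ℓ₀)
  have hinf0 : 0 ≤ ⨅ ℓ, performance P E E' f ℓ := Real.iInf_nonneg fun ℓ => (hPpos ℓ).le
  have : Nonempty (Fin p) := ⟨ℓ₀⟩
  have hinf : r * (⨅ ℓ, performance P E E' f ℓ) ≤ ⨅ ℓ, performance Q E E' f ℓ :=
    le_ciInf fun ℓ => (mul_le_mul_of_nonneg_left (ciInf_le bbP ℓ) hr0.le).trans (hratio ℓ).1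
  have hsup : r * (⨆ ℓ, performance Q E E' f ℓ) ≤ ⨆ ℓ, performance P E E' f ℓ := by
    rw [← le_div_iff₀' hr0]
    refine ciSup_le fun ℓ => ?_
    rw [le_div_iff₀' hr0]
    exact (hratio ℓ).2.trans (le_ciSup baP ℓ)
  unfold fairness
  rw [← mul_div_assoc, div_le_div_iff₀ hsupP hsupQ]
  calc _ = (r * ⨅ ℓ, performance P E E' f ℓ) * (r * ⨆ ℓ, performance Q E E' f ℓ) := by ring
    _ ≤ _ := mul_le_mul hinf hsup (by positivity) ((by positivity : (0:ℝ) ≤ _).trans hinf)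

/-- The empirical error takes finitely many values on measurable classifiers. -/
theorem finite_err_empirical {N : ℕ} (T : Fin N → Datum X p) {H : Set (Classifier X p)}
    (hH : ∀ f ∈ H, Measurable f) : (Set.image (err (empirical T)) H).Finite := by
  refine (Set.finite_range fun b : Fin N → Bool =>
    (∑ i, if b i ≠ (T i).2.1 then (1 : ℝ) else 0) / N).subset ?_
  rintro _ ⟨f, hf, rfl⟩
  refine ⟨fun i => predict f (T i), ?_⟩
  rw [err_eq, empirical_real T (measurableSet_at measurableSet_errEvent (hH f hf))]
  simp only [sampleCount]
  congr 1
  refine Finset.sum_congr rfl fun i _ => ?_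
  by_cases h : predict f (T i) = (T i).2.1 <;> simp [MetricEvent.at, errEvent, h]

/-- The minimum is attained because the empirical error takes finitely many values. -/
theorem exists_etOptimal {F : Set (Classifier X p)} (hF : ∀ f ∈ F, Measurable f)
    {E E' : MetricEvent X p} {τ η lam Δ : ℝ} {N : ℕ} {T : Fin N → Datum X p} {g : Classifier X p}
    (hg : ETFeasible F E E' τ η lam Δ T g) : ∃ f, ETOptimal F E E' τ η lam Δ T f := by
  have hfin := finite_err_empirical T (H := {f | ETFeasible F E E' τ η lam Δ T f})
    fun f hf => hF f hf.1
  obtain ⟨_, ⟨f, hf, rfl⟩, hmin⟩ := Set.exists_min_image _ id hfin ⟨_, g, hg, rfl⟩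
  exact ⟨f, hf, fun h hh => hmin _ ⟨h, hh, rfl⟩⟩

/-- The guarantee of the error-tolerant program on a sample whose empirical distribution is
uniformly `(η + Δ)`-close to `D`. -/
theorem etOptimal_guarantee [Nonempty (Fin p)] {D : Measure (Datum X p)} [IsProbabilityMeasure D]
    {F : Set (Classifier X p)} (hF : ∀ f ∈ F, Measurable f) {E E' : MetricEvent X p}
    (hE' : MeasurableSet E') {τ : ℝ} (hτ : 0 < τ) {fstar : Classifier X p}
    (hstar : IsOptimalFair F D E E' τ fstar) {lam : ℝ} (hlam : 0 < lam)
    (hjoint : ∀ ℓ, lam ≤ joint D E E' fstar ℓ) {η ε ν Δ : ℝ} (hη : 0 ≤ η) (hΔ : 0 < Δ)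
    (hε : 2 * (η + Δ) ≤ ε) (hlamΔ : 2 * (η + Δ) < lam) (hν : 8 * (η + Δ) * τ / lam ≤ ν)
    {N : ℕ} {T : Fin N → Datum X p}
    (herr : ∀ f ∈ F, |err (empirical T) f - err D f| ≤ η + Δ)
    (hj : ∀ f ∈ F, ∀ ℓ, |joint (empirical T) E E' f ℓ - joint D E E' f ℓ| ≤ η + Δ)
    (hc : ∀ f ∈ F, ∀ ℓ, |(empirical T).real ((groupEvent E' ℓ).at f) -
      D.real ((groupEvent E' ℓ).at f)| ≤ η + Δ) :
    (∃ f, ETOptimal F E E' τ η lam Δ T f) ∧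
      ∀ fET, ETOptimal F E E' τ η lam Δ T fET →
        err D fET - err D fstar ≤ ε ∧ τ - ν ≤ fairness D E E' fET := by
  set e := η + Δ with he
  have he0 : 0 ≤ e := by positivity
  have hfactor : (1 - e / lam) / (1 + e / lam) = (lam - e) / (lam + e) := by
    field_simp
  have hfeas : ETFeasible F E E' τ η lam Δ T fstar := by
    refine ⟨hstar.1.1, ?_, fun ℓ => ?_⟩
    · rw [← he, hfactor]
      refine le_trans ?_ (fairness_perturbation hE' (hF _ hstar.1.1) hlam he0 (by linarith) hjoint
        (hj _ hstar.1.1) (hc _ hstar.1.1))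
      rw [mul_comm]
      exact mul_le_mul_of_nonneg_left hstar.1.2 (sq_nonneg _)
    · have h1 := (abs_le.1 (hj _ hstar.1.1 ℓ)).1
      have h2 := hjoint ℓ
      linarith
  refine ⟨exists_etOptimal hF hfeas, fun f hf => ⟨?_, ?_⟩⟩
  · have h1 := (abs_le.1 (herr f hf.1.1)).1
    have h2 := (abs_le.1 (herr _ hstar.1.1)).2
    have h3 := hf.2 _ hfeas
    linarith
  · have : IsFiniteMeasure (empirical T) := by
      refine ⟨?_⟩
      rcases Nat.eq_zero_or_pos N with h | h
      · subst h; simp [empirical]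
      · simp only [empirical, Measure.smul_apply, Measure.finsetSum_apply, smul_eq_mul, measure_univ]
        simp [ENNReal.mul_lt_top_iff, h]
    obtain ⟨hfF, hfair, hfj⟩ := hf.1
    -- The roles of the two distributions are reversed; the lower bound `lam - e` comes from
    -- feasibility of `f`, as nothing is known about `joint D` at `f` beforehand.
    have h1 := fairness_perturbation (P := empirical T) (Q := D) (m := lam - e) (e := e) hE'
      (hF f hfF) (by linarith) he0 (by linarith) (fun ℓ => by have := hfj ℓ; linarith)
      (fun ℓ => by rw [abs_sub_comm]; exact hj f hfF ℓ)
      (fun ℓ => by rw [abs_sub_comm]; exact hc f hfF ℓ)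
    have h2 := loss_factor_ge hlam he0 hlamΔ
    rw [← he] at hfair
    calc τ - ν ≤ τ - 8 * e * τ / lam := by linarith
      _ = (1 - 8 * e / lam) * τ := by ring
      _ ≤ (((lam - e - e) / (lam - e + e)) ^ 2 * ((1 - e / lam) / (1 + e / lam)) ^ 2) * τ := by
          gcongr
      _ = ((lam - e - e) / (lam - e + e)) ^ 2 * (τ * ((1 - e / lam) / (1 + e / lam)) ^ 2) := by ring
      _ ≤ ((lam - e - e) / (lam - e + e)) ^ 2 * fairness (empirical T) E E' f := by gcongr
      _ ≤ _ := h1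

/-! ### Uniform convergence and sample size -/

/-- Uniform convergence over `F` of the frequencies of a metric event. -/
theorem measure_exists_event_deviation_le {D : Measure (Datum X p)} [IsProbabilityMeasure D]
    {F : Set (Classifier X p)} (hF : IsMeasurableClass F D) {d : ℕ} (hd : HasVCDim F d)
    {G : MetricEvent X p} (hG : MeasurableSet G) {N : ℕ} {Δ : ℝ} (hΔ : 0 < Δ)
    (hN : 2 ≤ N * Δ ^ 2) :
    (Measure.pi fun _ : Fin N => D)
        {S | ∃ f ∈ F, N * Δ < |sampleCount (G.at f) S - N * D.real (G.at f)|} ≤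
      ENNReal.ofReal (4 * (2 * N + 1) ^ d * Real.exp (-(N * Δ ^ 2 / 8))) := by
  have h := measure_exists_sampleCount_deviation_le D (𝒞 := eventFamily F G)
    (by rintro _ ⟨f, hf, rfl⟩; exact measurableSet_at hG (hF.1 f hf)) hΔ hN
    (fun b => hF.nullMeasurableSet_tracePatterns hG b)
    (fun T => ncard_tracePatterns_eventFamily_le hd G T)
  simp only [Fintype.card_sum, Fintype.card_fin] at h
  push_cast at h
  rw [← two_mul] at h
  refine (measure_mono ?_).trans h
  rintro S ⟨f, hf, hS⟩
  exact ⟨_, ⟨f, hf, rfl⟩, hS⟩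

end

/-- Each summand of the sample bound pays for half of `N Δ² / 8`. The second uses `log (2N + 1) ≤ 4
√N`, so that `64 d ≤ √N Δ²` suffices; squaring gives 4096. -/
theorem log_sample_size_le {d N : ℕ} {L Δ : ℝ} (hL : 0 ≤ L) (hΔ : 0 < Δ)
    (hN : 16 * (11 + L) * (1 / Δ) ^ 2 + 4096 * d ^ 2 * (1 / Δ) ^ 4 ≤ N) :
    11 + L + d * Real.log (2 * N + 1) ≤ N * Δ ^ 2 / 8 := by
  have hx : 0 < 1 / Δ := by positivity
  have h1 : 16 * (11 + L) * (1 / Δ) ^ 2 ≤ N := le_trans (le_add_of_nonneg_right (by positivity)) hN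
  have h2 : 4096 * d ^ 2 * (1 / Δ) ^ 4 ≤ N := le_trans (le_add_of_nonneg_left (by positivity)) hN
  have h1' : 11 + L ≤ N * Δ ^ 2 / 16 := by
    rw [one_div, inv_pow, ← div_eq_mul_inv, div_le_iff₀ (by positivity)] at h1
    linarith
  have hN0 : (0 : ℝ) < N := lt_of_lt_of_le (by positivity) h1
  have hN1 : (1 : ℝ) ≤ N := by exact_mod_cast Nat.one_le_iff_ne_zero.2 (by rintro rfl; simp at hN0)
  set s := Real.sqrt N with hs
  have hs0 : 0 < s := Real.sqrt_pos.2 hN0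
  have hss : s ^ 2 = N := Real.sq_sqrt hN0.le
  have hlog : Real.log (2 * N + 1) ≤ 4 * s := by
    have h3 : (2 * N + 1 : ℝ) ≤ (2 * s) ^ 2 := by rw [mul_pow, hss]; linarith
    have h4 : Real.log (2 * N + 1) ≤ Real.log ((2 * s) ^ 2) := Real.log_le_log (by positivity) h3
    rw [Real.log_pow] at h4
    have h5 := Real.log_le_sub_one_of_pos (show 0 < 2 * s by positivity)
    push_cast at h4
    linarith
  have h6 : 64 * d ≤ s * Δ ^ 2 := by
    have : (64 * d * (1 / Δ) ^ 2 : ℝ) ^ 2 ≤ s ^ 2 := by rw [hss]; refine le_trans (le_of_eq ?_) h2; ring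
    have h7 := (pow_le_pow_iff_left₀ (by positivity) hs0.le two_ne_zero).1 this
    rwa [one_div, inv_pow, ← div_eq_mul_inv, div_le_iff₀ (by positivity)] at h7
  have h8 : d * Real.log (2 * N + 1) ≤ N * Δ ^ 2 / 16 := by
    calc (d : ℝ) * Real.log (2 * N + 1) ≤ d * (4 * s) := by gcongr
      _ = 64 * d * s / 16 := by ring
      _ ≤ s * Δ ^ 2 * s / 16 := by gcongr
      _ = _ := by rw [← hss]; ring
  linarith

/-- The 11 absorbs the constant: `2p + 1 ≤ 3p` and `3 * 4 = 12 ≤ exp 11`. The term `log (p / δ)`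
turns the remaining factor `p` into `δ`. -/
theorem failure_probability_le {p d N : ℕ} (hp : 0 < p) {δ Δ : ℝ} (hδ : 0 < δ) (hδ1 : δ < 1)
    (hΔ : 0 < Δ) (hN : 16 * (11 + Real.log (p / δ)) * (1 / Δ) ^ 2 + 4096 * d ^ 2 * (1 / Δ) ^ 4 ≤ N) :
    2 ≤ N * Δ ^ 2 ∧
      (2 * p + 1) * (4 * (2 * N + 1) ^ d * Real.exp (-(N * Δ ^ 2 / 8))) ≤ δ := by
  have hp1 : (1 : ℝ) ≤ p := by exact_mod_cast hp
  have hL : 0 ≤ Real.log (p / δ) := Real.log_nonneg (by rw [le_div_iff₀ hδ]; linarith)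
  have h := log_sample_size_le hL hΔ hN
  have hlog : 0 ≤ d * Real.log (2 * N + 1) :=
    mul_nonneg (by positivity) (Real.log_nonneg (by linarith [N.cast_nonneg (α := ℝ)]))
  refine ⟨by linarith, ?_⟩
  have hexpL : (p : ℝ) = δ * Real.exp (Real.log (p / δ)) := by
    rw [Real.exp_log (by positivity)]; field_simp
  have hpow : ((2 * N + 1 : ℝ)) ^ d = Real.exp (d * Real.log (2 * N + 1)) := by
    rw [Real.exp_nat_mul, Real.exp_log (by positivity)]
  have h12 : (12 : ℝ) ≤ Real.exp 11 := by
    have := Real.add_one_le_exp (11 : ℝ); linarith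
  calc (2 * p + 1) * (4 * (2 * N + 1) ^ d * Real.exp (-(N * Δ ^ 2 / 8)))
      ≤ (3 * p) * (4 * (2 * N + 1) ^ d * Real.exp (-(N * Δ ^ 2 / 8))) := by
        gcongr; linarith
    _ = 12 * p * (2 * N + 1) ^ d * Real.exp (-(N * Δ ^ 2 / 8)) := by ring
    _ ≤ Real.exp 11 * p * (2 * N + 1) ^ d * Real.exp (-(N * Δ ^ 2 / 8)) := by gcongr
    _ = δ * Real.exp (11 + Real.log (p / δ) + d * Real.log (2 * N + 1) - N * Δ ^ 2 / 8) := by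
        rw [hpow, Real.exp_sub, Real.exp_add, Real.exp_add, Real.exp_neg]
        nth_rewrite 1 [hexpL]
        field_simp
    _ ≤ δ * 1 := by
        gcongr
        exact Real.exp_le_one_iff.2 (by linarith)
    _ = δ := mul_one δ

end FairLearning

/-! ### The main theorem -/

open FairLearning in
/-- The polynomial `P` is universal. The event that fails with probability at most `δ` is measured
by the outer measure, so that nothing is assumed about the measurability of the adversary or of the
choice of the optimal solution. -/
theorem theorem4p3 :
    ∃ P : MvPolynomial (Fin 3) ℝ,
      ∀ (X : Type*) [MeasurableSpace X] (p d : ℕ)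
        (D : Measure (Datum X p)) [IsProbabilityMeasure D]
        (F : Set (Classifier X p)) (_ : IsMeasurableClass F D) (_ : HasVCDim F d)
        (E E' : MetricEvent X p) (_ : MeasurableSet E) (_ : MeasurableSet E')
        (τ : ℝ) (_ : 0 < τ) (_ : τ ≤ 1)
        (fstar : Classifier X p) (_ : IsOptimalFair F D E E' τ fstar)
        (lam : ℝ) (_ : 0 < lam) (_ : ∀ ℓ, lam ≤ joint D E E' fstar ℓ)
        (η : ℝ) (_ : 0 ≤ η) (_ : η < lam / 2)
        (ε : ℝ) (_ : 2 * η < ε)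
        (ν : ℝ) (_ : 8 * η * τ / (lam - 2 * η) < ν)
        (δ : ℝ) (_ : 0 < δ) (_ : δ < 1)
        (Δ : ℝ) (_ : 0 < Δ)
        (_ : Δ ≤ min (min (ε - 2 * η) ((lam - 2 * η) * (ν - 8 * η * τ / (lam - 2 * η))))
          (lam - 2 * η) / 96)
        (N : ℕ) (_ : MvPolynomial.eval ![(d : ℝ), 1 / Δ, Real.log (p / δ)] P ≤ N)
        (R : Type*) [MeasurableSpace R] (ρ : Measure R) [IsProbabilityMeasure ρ]
        (A : R → (Fin N → Datum X p) → (Fin N → Datum X p)) (_ : IsHammingAdversary η A),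
        (ρ.prod (Measure.pi fun _ : Fin N => D))
          {ω | ¬ ((∃ f, ETOptimal F E E' τ η lam Δ (A ω.1 ω.2) f) ∧
            ∀ fET, ETOptimal F E E' τ η lam Δ (A ω.1 ω.2) fET →
              err D fET - err D fstar ≤ ε ∧ τ - ν ≤ fairness D E E' fET)} ≤
          ENNReal.ofReal δ := by
  refine ⟨MvPolynomial.C 16 * (MvPolynomial.C 11 + MvPolynomial.X 2) * MvPolynomial.X 1 ^ 2 +
    MvPolynomial.C 4096 * MvPolynomial.X 0 ^ 2 * MvPolynomial.X 1 ^ 4, ?_⟩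
  intro X _ p d D _ F hF hd E E' hE hE' τ hτ hτ1 fstar hstar lam hlam hjoint η hη hηlam ε _ ν _
    δ hδ hδ1 Δ hΔ hΔle N hN R _ ρ _ A hA
  have hN : 16 * (11 + Real.log (p / δ)) * (1 / Δ) ^ 2 + 4096 * d ^ 2 * (1 / Δ) ^ 4 ≤ N := by
    simpa using hN
  obtain ⟨w⟩ := nonempty_of_isProbabilityMeasure D
  have : Nonempty (Fin p) := ⟨w.2.2⟩
  have hp : 0 < p := Fin.pos_iff_nonempty.2 inferInstance
  obtain ⟨hN2, hfail⟩ := failure_probability_le hp hδ hδ1 hΔ hN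
  have hN0 : 0 < N := Nat.pos_of_ne_zero (by rintro rfl; norm_num at hN2)
  have hgap : 0 < lam - 2 * η := by linarith
  rw [le_div_iff₀ (by norm_num), le_min_iff, le_min_iff] at hΔle
  obtain ⟨⟨hΔε, hΔν⟩, hΔlam⟩ := hΔle
  -- As `τ ≤ 1`, the increment `8 Δ τ` fits into the slack `(lam - 2η) ν - 8 η τ`; the constant 96
  -- is more than enough.
  have hν : 8 * (η + Δ) * τ / lam ≤ ν := by
    rw [mul_sub, mul_div_cancel₀ _ hgap.ne'] at hΔν
    have h1 : 8 * (η + Δ) * τ ≤ (lam - 2 * η) * ν := by nlinarith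
    have hν0 : 0 ≤ ν := by
      by_contra hneg
      have : (lam - 2 * η) * ν < 0 := mul_neg_of_pos_of_neg hgap (not_le.1 hneg)
      have : 0 ≤ 8 * (η + Δ) * τ := by positivity
      linarith
    rw [div_le_iff₀ hlam]
    nlinarith
  let G : Option (Fin p ⊕ Fin p) → MetricEvent X p := fun k =>
    k.elim errEvent (Sum.elim (groupEvent (E ∩ E')) (groupEvent E'))
  have hG : ∀ k, MeasurableSet (G k) := by
    rintro (_ | ℓ | ℓ)
    · exact measurableSet_errEvent
    · exact measurableSet_groupEvent (hE.inter hE') ℓ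
    · exact measurableSet_groupEvent hE' ℓ
  -- The bad event concerns only the clean samples, so neither the adversary's randomness nor its
  -- dependence on `S` matters.
  let bad : Set (Fin N → Datum X p) := ⋃ k,
    {S | ∃ f ∈ F, N * Δ < |sampleCount ((G k).at f) S - N * D.real ((G k).at f)|}
  have hbad : (Measure.pi fun _ : Fin N => D) bad ≤ ENNReal.ofReal δ := by
    refine (measure_iUnion_fintype_le _ _).trans ((Finset.sum_le_sum fun k _ =>
      measure_exists_event_deviation_le hF hd (hG k) hΔ hN2).trans ?_)
    rw [Finset.sum_const, Finset.card_univ, Fintype.card_option, Fintype.card_sum, Fintype.card_fin,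
      nsmul_eq_mul, ← ENNReal.ofReal_natCast, ← ENNReal.ofReal_mul (by positivity)]
    refine ENNReal.ofReal_le_ofReal (le_trans (le_of_eq ?_) hfail)
    push_cast
    ring
  have hsub : {ω : R × (Fin N → Datum X p) | ¬ ((∃ f, ETOptimal F E E' τ η lam Δ (A ω.1 ω.2) f) ∧
      ∀ fET, ETOptimal F E E' τ η lam Δ (A ω.1 ω.2) fET →
        err D fET - err D fstar ≤ ε ∧ τ - ν ≤ fairness D E E' fET)} ⊆ Set.univ ×ˢ bad := by
    rintro ⟨r, S⟩ hω
    refine ⟨Set.mem_univ _, ?_⟩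
    by_contra hS
    refine hω ?_
    have hclose : ∀ k, ∀ f ∈ F,
        |(empirical (A r S)).real ((G k).at f) - D.real ((G k).at f)| ≤ η + Δ := by
      intro k f hf
      refine (hA r S).abs_empirical_sub_le hN0 (measurableSet_at (hG k) (hF.1 f hf)) ?_
      by_contra hlt
      exact hS (Set.mem_iUnion.2 ⟨k, f, hf, not_le.1 hlt⟩)
    exact etOptimal_guarantee hF.1 hE' hτ hstar hlam hjoint hη hΔ (by linarith) (by linarith)
      hν (hclose none) (fun f hf ℓ => hclose (some (Sum.inl ℓ)) f hf)
      (fun f hf ℓ => hclose (some (Sum.inr ℓ)) f hf)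
  calc _ ≤ (ρ.prod (Measure.pi fun _ : Fin N => D)) (Set.univ ×ˢ bad) := measure_mono hsub
    -- The product formula holds for arbitrary sets, so `bad` need not be measurable.
    _ = (Measure.pi fun _ : Fin N => D) bad := by rw [Measure.prod_prod]; simp
    _ ≤ _ := hbad
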